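/- Let $\mathbb{F}=abaababaabaab\cdots$ be the Fibonacci sequence, i.e. the infinite word beginning with $a$ that is fixed by the morphism $a\mapsto ab$, $b\mapsto a$, and let $f_{-2}=0$, $f_{-1}=1$, $f_m=f_{m-1}+f_{m-2}$ for $m\ge 0$. Let $\mathcal{P}_F$ be the set of all nonempty palindromes that occur as factors of $\mathbb{F}$. For a factor $\omega$ of $\mathbb{F}$ and $p\ge 1$ let $\omega_p$ be the $p$-th occurrence of $\omega$ in $\mathbb{F}$ (from left to right), and for $n\ge 0$ let $$A(n)=\#\{(\omega,p) : \omega\in\mathcal{P}_F,\ p\ge 1,\ \omega_p \text{ lies within the prefix of } \mathbb{F} \text{ of length } n\}.$$ Then for every integer $m\ge 2$ $$A(f_m-2)=\sum_{i=-1}^{m} f_i f_{m-i-1}-f_{m+2}-f_m+2=\frac{m-3}{5}f_{m+2}+\frac{m-1}{5}f_m+2 .$$ Moreover, the numbers $C(m)=A(f_{m+1}-2)-A(f_m-2)$, $m\ge 1$, satisfy $C(m)=C(m-1)+C(m-2)+f_{m-1}$ for every $m\ge 3$. -/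

import Mathlib

namespace FibPal

/-- The two-letter alphabet. -/
inductive Letter
  | a
  | b
  deriving DecidableEq

/-- The Fibonacci numbers with the indexing `f (-2) = 0`, `f (-1) = 1`,
`f m = f (m - 1) + f (m - 2)` for `m ≥ 0`. -/
def f (m : ℤ) : ℕ := Nat.fib (m + 2).toNat

theorem f_neg_two : f (-2) = 0 := rfl

theorem f_neg_one : f (-1) = 1 := rfl

theorem f_rec (m : ℤ) (hm : 0 ≤ m) : f m = f (m - 1) + f (m - 2) := by
  obtain ⟨k, rfl⟩ := Int.eq_ofNat_of_zero_le hm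
  have h0 : ((k : ℤ) + 2).toNat = k + 2 := by omega
  have h1 : ((k : ℤ) - 1 + 2).toNat = k + 1 := by omega
  have h2 : ((k : ℤ) - 2 + 2).toNat = k := by omega
  simp only [f, h0, h1, h2]
  rw [Nat.fib_add_two, add_comm]

/-- The morphism `a ↦ ab`, `b ↦ a` on letters. -/
def sigmaLetter : Letter → List Letter
  | .a => [.a, .b]
  | .b => [.a]

/-- The morphism `a ↦ ab`, `b ↦ a` on finite words. -/
def sigma (w : List Letter) : List Letter := w.flatMap sigmaLetter

/-- The finite word obtained by applying the morphism `m` times to the one-letter word `a`. -/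
def finiteWord (m : ℕ) : List Letter := sigma^[m] [.a]

/-- The Fibonacci sequence: `fibWord i` is its `(i + 1)`-st letter. All words `finiteWord m` are
prefixes of one another, and the `i`-th one has more than `i` letters, so the default value of
`getD` is never used (see `finiteWord_eq_prefix` and `sigma_prefix` below). -/
def fibWord (i : ℕ) : Letter := (finiteWord i).getD i .a

/-- The factor of length `l` of the Fibonacci sequence that is preceded by exactly `i` letters. -/
def factor (i l : ℕ) : List Letter := (List.range l).map fun k => fibWord (i + k)

/-- The word `w` occurs in the Fibonacci sequence with exactly `i` letters before it, that is,
its first letter has the (one-based) position `i + 1` and its last letter `i + |w|`. -/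
def OccursAt (w : List Letter) (i : ℕ) : Prop := factor i w.length = w

/-- The `p`-th occurrence of `w` (numbered `p = 1, 2, …` from left to right) is the one that is
preceded by exactly `i` letters. -/
def IsNthOccurrence (w : List Letter) (p i : ℕ) : Prop :=
  OccursAt w i ∧ {j : ℕ | j ≤ i ∧ OccursAt w j}.ncard = p

/-- The set of (nonempty) palindromes that occur in the Fibonacci sequence. -/
def palindromes : Set (List Letter) :=
  {w | w ≠ [] ∧ w.Palindrome ∧ ∃ i, OccursAt w i}

/-- The pairs `(w, p)` where `w` is a palindrome of the Fibonacci sequence whose `p`-th occurrence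
lies within the prefix of length `n`. -/
def occurrencePairs (n : ℕ) : Set (List Letter × ℕ) :=
  {q | q.1 ∈ palindromes ∧ ∃ i, IsNthOccurrence q.1 q.2 i ∧ i + q.1.length ≤ n}

/-- The number of repeated palindromes in the prefix of length `n` of the Fibonacci sequence. -/
noncomputable def A (n : ℕ) : ℕ := (occurrencePairs n).ncard

/-- The increments `C m = A (f (m + 1) - 2) - A (f m - 2)`, used for `m ≥ 1` only,
where `f m ≥ 2`. -/
noncomputable def C (m : ℤ) : ℤ := (A (f (m + 1) - 2) : ℤ) - (A (f m - 2) : ℤ)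

/-! Sanity facts: the definitions above describe the intended objects. -/

theorem occurrencePairs_finite (n : ℕ) : (occurrencePairs n).Finite := by
  refine (((Set.finite_Iic n).prod (Set.finite_Iic n)).image
    (fun x : ℕ × ℕ => (factor x.1 x.2,
      {j : ℕ | j ≤ x.1 ∧ OccursAt (factor x.1 x.2) j}.ncard))).subset ?_
  rintro ⟨w, p⟩ ⟨-, i, ⟨h1, h2⟩, h3⟩
  dsimp only at h1 h2 h3
  refine ⟨(i, w.length), ⟨?_, ?_⟩, ?_⟩
  · simp only [Set.mem_Iic]; omega
  · simp only [Set.mem_Iic]; omega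
  · have h : factor i w.length = w := h1
    simp only [h, h2]

theorem sigma_append (u v : List Letter) : sigma (u ++ v) = sigma u ++ sigma v := by
  simp [sigma]

theorem finiteWord_succ (m : ℕ) : finiteWord (m + 1) = sigma (finiteWord m) := by
  simp only [finiteWord, Function.iterate_succ_apply']

theorem finiteWord_add_two (m : ℕ) :
    finiteWord (m + 2) = finiteWord (m + 1) ++ finiteWord m := by
  induction m with
  | zero => rfl
  | succ m ih =>
    rw [finiteWord_succ (m + 2), ih, sigma_append, ← finiteWord_succ, ← finiteWord_succ,
      ← ih]

theorem finiteWord_length (m : ℕ) : (finiteWord m).length = f m := by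
  have key : ∀ m : ℕ, (finiteWord m).length = Nat.fib (m + 2) ∧
      (finiteWord (m + 1)).length = Nat.fib (m + 3) := by
    intro m
    induction m with
    | zero => exact ⟨rfl, rfl⟩
    | succ m ih =>
      refine ⟨ih.2, ?_⟩
      rw [finiteWord_add_two, List.length_append, ih.1, ih.2, Nat.fib_add_two (n := m + 2)]
      ring
  have h : ((m : ℤ) + 2).toNat = m + 2 := by omega
  rw [(key m).1, f, h]

theorem lt_length_finiteWord (m : ℕ) : m < (finiteWord m).length := by
  have h : ((m : ℤ) + 2).toNat = m + 2 := by omega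
  rw [finiteWord_length, f, h]
  induction m with
  | zero => decide
  | succ m ih =>
    have h1 := ih (by omega)
    have h2 : Nat.fib (m + 3) = Nat.fib (m + 1) + Nat.fib (m + 2) := Nat.fib_add_two
    have h3 : 0 < Nat.fib (m + 1) := Nat.fib_pos.2 (by omega)
    change m + 1 < Nat.fib (m + 3)
    omega

theorem finiteWord_prefix_succ (m : ℕ) : finiteWord m <+: finiteWord (m + 1) := by
  cases m with
  | zero => exact ⟨[.b], rfl⟩
  | succ m => rw [finiteWord_add_two]; exact List.prefix_append _ _

theorem finiteWord_prefix {m n : ℕ} (h : m ≤ n) : finiteWord m <+: finiteWord n := by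
  induction n, h using Nat.le_induction with
  | base => exact List.prefix_refl _
  | succ n _ ih => exact ih.trans (finiteWord_prefix_succ n)

theorem fibWord_eq {m i : ℕ} (h : i < (finiteWord m).length) :
    fibWord i = (finiteWord m)[i] := by
  have hi := lt_length_finiteWord i
  have e : fibWord i = (finiteWord i)[i] := by
    simp only [fibWord, List.getD_eq_getElem?_getD, List.getElem?_eq_getElem hi, Option.getD_some]
  rw [e]
  rcases le_total m i with hm | hm
  · exact ((finiteWord_prefix hm).getElem h).symm
  · exact (finiteWord_prefix hm).getElem hi

/-- A prefix of a `finiteWord` is a prefix of the Fibonacci sequence. -/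
theorem factor_of_prefix {w : List Letter} {m : ℕ} (h : w <+: finiteWord m) :
    factor 0 w.length = w := by
  apply List.ext_getElem
  · simp [factor]
  · intro k h1 h2
    have h3 : k < (finiteWord m).length := lt_of_lt_of_le h2 h.length_le
    simp only [factor, List.getElem_map, List.getElem_range, zero_add]
    rw [fibWord_eq h3]
    exact (h.getElem h2).symm

/-- Every `finiteWord m` is the prefix of length `f m` of the Fibonacci sequence. -/
theorem finiteWord_eq_prefix (m : ℕ) : factor 0 (f m) = finiteWord m := by
  rw [← finiteWord_length]
  exact factor_of_prefix (List.prefix_refl _)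

/-- The Fibonacci sequence begins with `a`. -/
theorem fibWord_zero : fibWord 0 = .a := rfl

/-- The Fibonacci sequence is fixed by the morphism: the image of each of its prefixes is again
a prefix of it. -/
theorem sigma_prefix (n : ℕ) :
    factor 0 (sigma (factor 0 n)).length = sigma (factor 0 n) := by
  have h : factor 0 n <+: finiteWord n := by
    rw [← finiteWord_eq_prefix n]
    have hn : n ≤ f n := by
      rw [← finiteWord_length]; exact (lt_length_finiteWord n).le
    obtain ⟨d, hd⟩ := Nat.exists_eq_add_of_le hn
    rw [hd]
    simp only [factor, List.range_add, List.map_append]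
    exact List.prefix_append _ _
  obtain ⟨t, ht⟩ := h
  refine factor_of_prefix (m := n + 1) ⟨sigma t, ?_⟩
  rw [finiteWord_succ, ← ht, sigma_append]

end FibPal

namespace FibPal

/-! ### Factors and the morphism -/

/-! Repeated palindromes are counted as palindromic intervals (`A_eq`), split by first letter, and
the morphism σ relates the counts for consecutive Fibonacci lengths. A palindrome starting with a
also ends with a and is σ(w)a for a unique, possibly empty palindrome w; one starting with b is such
a word σ(w)a stripped of its outer letters, where w starts with a. If α and β count the two kinds in
the prefix of length n, the prefix of length |σ(prefix)| + 1 therefore has α + β + n + 1 and α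
(`ncard_palIntervals_a_imageLength`, `ncard_palIntervals_b_imageLength`).

The lengths f_m - 2 are stable under this passage (`imageLength_fib_sub_two`). Two applications give
A(f_{m+2} - 2) = A(f_{m+1} - 2) + A(f_m - 2) + f_{m+2} - 2 (`A_fib_recurrence`). The closed form
follows by induction, the sum by evaluating the Fibonacci convolution (`sum_fib_mul_fib`), and the
recurrence for C by subtracting consecutive instances. -/

theorem factor_add (i k l : ℕ) : factor i (k + l) = factor i k ++ factor (i + k) l := by
  simp [factor, List.range_add, Function.comp_def, add_assoc]

theorem factor_one (i : ℕ) : factor i 1 = [fibWord i] := by simp [factor]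

theorem factor_length (i l : ℕ) : (factor i l).length = l := by simp [factor]

theorem factor_succ' (i l : ℕ) : factor i (l + 1) = fibWord i :: factor (i + 1) l := by
  rw [add_comm, factor_add, factor_one]; rfl

theorem factor_succ (i l : ℕ) : factor i (l + 1) = factor i l ++ [fibWord (i + l)] := by
  rw [factor_add, factor_one]

theorem Letter.eq_a_or_eq_b (x : Letter) : x = .a ∨ x = .b := by cases x <;> simp

/-- The length of the image under the morphism of the prefix of length `n`. -/
def imageLength (n : ℕ) : ℕ := (sigma (factor 0 n)).length

theorem factor_imageLength (n : ℕ) : factor 0 (imageLength n) = sigma (factor 0 n) :=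
  sigma_prefix n

theorem sigma_singleton (x : Letter) : sigma [x] = sigmaLetter x := by simp [sigma]

theorem imageLength_zero : imageLength 0 = 0 := rfl

theorem imageLength_succ (n : ℕ) :
    imageLength (n + 1) = imageLength n + (sigmaLetter (fibWord n)).length := by
  simp [imageLength, factor_succ, sigma_append, sigma_singleton]

theorem factor_imageLength_letter (n : ℕ) :
    factor (imageLength n) (sigmaLetter (fibWord n)).length = sigmaLetter (fibWord n) := by
  have h := factor_imageLength (n + 1)
  rw [imageLength_succ, factor_add, factor_succ, sigma_append, factor_imageLength,
    sigma_singleton, zero_add, zero_add] at h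
  exact List.append_cancel_left h

theorem imageLength_succ_a {n : ℕ} (h : fibWord n = .a) :
    imageLength (n + 1) = imageLength n + 2 := by
  rw [imageLength_succ, h]; rfl

theorem imageLength_succ_b {n : ℕ} (h : fibWord n = .b) :
    imageLength (n + 1) = imageLength n + 1 := by
  rw [imageLength_succ, h]; rfl

theorem fibWord_imageLength (n : ℕ) : fibWord (imageLength n) = .a := by
  have h := factor_imageLength_letter n
  rcases (fibWord n).eq_a_or_eq_b with e | e <;> rw [e] at h <;>
    simp [sigmaLetter, factor_succ'] at h <;> exact h.1

theorem fibWord_imageLength_succ {n : ℕ} (e : fibWord n = .a) :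
    fibWord (imageLength n + 1) = .b := by
  have h := factor_imageLength_letter n
  rw [e] at h
  simp [sigmaLetter, factor_succ'] at h
  exact h.2.1

theorem imageLength_strictMono : StrictMono imageLength := by
  refine strictMono_nat_of_lt_succ fun n => ?_
  rcases (fibWord n).eq_a_or_eq_b with e | e
  · rw [imageLength_succ_a e]; omega
  · rw [imageLength_succ_b e]; omega

/-- Every position of the Fibonacci sequence is the first or the second one of the image of a
letter. -/
theorem exists_imageLength (k : ℕ) :
    (∃ n, k = imageLength n) ∨ ∃ n, fibWord n = .a ∧ k = imageLength n + 1 := by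
  induction k with
  | zero => exact .inl ⟨0, rfl⟩
  | succ k ih =>
    rcases ih with ⟨n, rfl⟩ | ⟨n, hn, rfl⟩
    · rcases (fibWord n).eq_a_or_eq_b with e | e
      · exact .inr ⟨n, e, rfl⟩
      · exact .inl ⟨n + 1, (imageLength_succ_b e).symm⟩
    · exact .inl ⟨n + 1, (imageLength_succ_a hn).symm⟩

theorem exists_imageLength_of_a {k : ℕ} (h : fibWord k = .a) : ∃ n, k = imageLength n := by
  rcases exists_imageLength k with h1 | ⟨n, hn, rfl⟩
  · exact h1
  · rw [fibWord_imageLength_succ hn] at h; cases h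

theorem exists_imageLength_of_b {k : ℕ} (h : fibWord k = .b) :
    ∃ n, fibWord n = .a ∧ k = imageLength n + 1 := by
  rcases exists_imageLength k with ⟨n, rfl⟩ | h1
  · rw [fibWord_imageLength] at h; cases h
  · exact h1

/-! ### Intervals of the Fibonacci sequence -/

/-- The factor of the Fibonacci sequence on the positions `i, …, j - 1`. -/
def seg (i j : ℕ) : List Letter := factor i (j - i)

theorem seg_length (i j : ℕ) : (seg i j).length = j - i := factor_length _ _

theorem seg_succ {i j : ℕ} (h : i ≤ j) : seg i (j + 1) = seg i j ++ [fibWord j] := by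
  obtain ⟨l, rfl⟩ := Nat.exists_eq_add_of_le h
  simp only [seg]
  rw [show i + l + 1 - i = l + 1 by omega, show i + l - i = l by omega, factor_succ]

theorem seg_eq_cons {i j : ℕ} (h : i < j) : seg i j = fibWord i :: seg (i + 1) j := by
  simp only [seg]
  rw [show j - i = j - (i + 1) + 1 by omega, factor_succ']

theorem seg_self (i : ℕ) : seg i i = [] := by simp [seg, factor]

theorem fibWord_eq_of_seg_palindrome {i j : ℕ} (h : i ≤ j) (hp : (seg i (j + 1)).Palindrome) :
    fibWord j = fibWord i := by
  have h1 := hp.reverse_eq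
  rw [seg_succ h, List.reverse_append, ← seg_succ h, seg_eq_cons (Nat.lt_succ_of_le h)] at h1
  simp at h1
  exact h1.1

theorem seg_imageLength {i j : ℕ} (h : i ≤ j) :
    seg (imageLength i) (imageLength j) = sigma (seg i j) := by
  induction j, h using Nat.le_induction with
  | base => simp [seg_self, sigma]
  | succ j h ih =>
    have hL := imageLength_strictMono.monotone h
    rw [seg_succ h, sigma_append, ← ih, sigma_singleton]
    rcases (fibWord j).eq_a_or_eq_b with e | e
    · rw [imageLength_succ_a e, e, seg_succ (by omega), seg_succ hL, fibWord_imageLength,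
        fibWord_imageLength_succ e]
      simp [sigmaLetter]
    · rw [imageLength_succ_b e, e, seg_succ hL, fibWord_imageLength]
      simp [sigmaLetter]

/-- The extra a is the first letter of the next image, whichever letter is being mapped. -/
theorem seg_imageLength_succ {i j : ℕ} (h : i ≤ j) :
    seg (imageLength i) (imageLength j + 1) = sigma (seg i j) ++ [.a] := by
  rw [seg_succ (imageLength_strictMono.monotone h), seg_imageLength h, fibWord_imageLength]

/-- Letter by letter this is a·ba = ab·a and a·a = a·a: σ is conjugate by a to its mirror image. -/
theorem cons_reverse_sigma (w : List Letter) :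
    .a :: (sigma w).reverse = sigma w.reverse ++ [.a] := by
  induction w with
  | nil => rfl
  | cons x w ih =>
    rw [← List.singleton_append (l := w), sigma_append, List.reverse_append,
      List.reverse_append, sigma_append, ← List.cons_append, ih]
    cases x <;> simp [sigma, sigmaLetter]

/-- Decoding needs one letter of look-ahead: thanks to the final a, every image is followed by an a,
so the image a cannot be confused with the start of ab. -/
theorem sigma_append_a_injective {v w : List Letter}
    (h : sigma v ++ [.a] = sigma w ++ [.a]) : v = w := by
  have aux : ∀ u : List Letter, ∃ t, sigma u ++ [.a] = .a :: t := by
    intro u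
    rcases u with _ | ⟨x, u⟩
    · exact ⟨[], rfl⟩
    · cases x <;> simp [sigma, sigmaLetter]
  induction v generalizing w with
  | nil =>
    rcases w with _ | ⟨x, w⟩
    · rfl
    · cases x <;> simp [sigma, sigmaLetter] at h
  | cons x v ih =>
    rcases w with _ | ⟨y, w⟩
    · cases x <;> simp [sigma, sigmaLetter] at h
    · have cons_eq : ∀ (z : Letter) (u : List Letter),
          sigma (z :: u) ++ [.a] = sigmaLetter z ++ (sigma u ++ [.a]) := by
        intro z u; simp [sigma]
      rw [cons_eq, cons_eq] at h
      obtain ⟨s, hs⟩ := aux v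
      obtain ⟨t, ht⟩ := aux w
      cases x <;> cases y
      · rw [ih (List.append_cancel_left h)]
      · rw [ht] at h; simp [sigmaLetter] at h
      · rw [hs] at h; simp [sigmaLetter] at h
      · rw [ih (List.append_cancel_left h)]

theorem palindrome_sigma_append_iff (w : List Letter) :
    (sigma w ++ [Letter.a]).Palindrome ↔ w.Palindrome := by
  rw [List.Palindrome.iff_reverse_eq, List.Palindrome.iff_reverse_eq, List.reverse_append]
  change Letter.a :: (sigma w).reverse = _ ↔ _
  rw [cons_reverse_sigma]
  exact ⟨sigma_append_a_injective, fun h => by rw [h]⟩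

theorem palindrome_seg_imageLength_succ_iff {i j : ℕ} (h : i ≤ j) :
    (seg (imageLength i) (imageLength j + 1)).Palindrome ↔ (seg i j).Palindrome := by
  rw [seg_imageLength_succ h, palindrome_sigma_append_iff]

theorem palindrome_cons_append_iff (x : Letter) (w : List Letter) :
    (x :: (w ++ [x])).Palindrome ↔ w.Palindrome := by
  simp [List.Palindrome.iff_reverse_eq]

theorem palindrome_seg_succ_imageLength_iff {i j : ℕ} (h : i < j) :
    (seg (imageLength i + 1) (imageLength j)).Palindrome ↔ (seg i j).Palindrome := by
  have hL := imageLength_strictMono h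
  rw [← palindrome_seg_imageLength_succ_iff h.le,
    seg_eq_cons (show imageLength i < imageLength j + 1 by omega),
    seg_succ (show imageLength i + 1 ≤ imageLength j by omega), fibWord_imageLength,
    fibWord_imageLength, palindrome_cons_append_iff]

/-! ### Counting palindromic intervals -/

/-- The nonempty intervals of the prefix of length `n` that carry a palindrome beginning
with `c`. -/
def palIntervals (c : Letter) (n : ℕ) : Set (ℕ × ℕ) :=
  {q | q.1 < q.2 ∧ q.2 ≤ n ∧ fibWord q.1 = c ∧ (seg q.1 q.2).Palindrome}

/-- The possibly empty intervals of the prefix of length `n` that carry a palindrome. -/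
def palIntervalsWithEmpty (n : ℕ) : Set (ℕ × ℕ) :=
  {q | q.1 ≤ q.2 ∧ q.2 ≤ n ∧ (seg q.1 q.2).Palindrome}

theorem palIntervals_finite (c : Letter) (n : ℕ) : (palIntervals c n).Finite := by
  refine ((Set.finite_Iic n).prod (Set.finite_Iic n)).subset ?_
  rintro ⟨i, j⟩ ⟨h1, h2, -⟩
  simp only [Set.mem_prod, Set.mem_Iic] at *
  omega

theorem palIntervals_disjoint (n : ℕ) : Disjoint (palIntervals .a n) (palIntervals .b n) := by
  rw [Set.disjoint_left]
  rintro q ⟨-, -, h1, -⟩ ⟨-, -, h2, -⟩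
  rw [h1] at h2; cases h2

theorem ncard_palIntervalsWithEmpty (n : ℕ) :
    (palIntervalsWithEmpty n).ncard =
      (palIntervals .a n).ncard + (palIntervals .b n).ncard + (n + 1) := by
  have hfin := (palIntervals_finite .a n).union (palIntervals_finite .b n)
  have e : palIntervalsWithEmpty n =
      (palIntervals .a n ∪ palIntervals .b n) ∪ (fun i => (i, i)) '' Set.Iic n := by
    ext ⟨i, j⟩
    simp only [palIntervalsWithEmpty, palIntervals, Set.mem_union, Set.mem_ofPred_eq,
      Set.mem_image, Set.mem_Iic, Prod.mk.injEq]
    constructor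
    · rintro ⟨h1, h2, h3⟩
      rcases h1.lt_or_eq with h | rfl
      · rcases (fibWord i).eq_a_or_eq_b with e | e
        · exact .inl (.inl ⟨h, h2, e, h3⟩)
        · exact .inl (.inr ⟨h, h2, e, h3⟩)
      · exact .inr ⟨i, h2, rfl, rfl⟩
    · rintro ((⟨h1, h2, -, h3⟩ | ⟨h1, h2, -, h3⟩) | ⟨k, hk, rfl, rfl⟩)
      · exact ⟨h1.le, h2, h3⟩
      · exact ⟨h1.le, h2, h3⟩
      · exact ⟨le_rfl, hk, by rw [seg_self]; exact .nil⟩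
  have hd : Disjoint (palIntervals .a n ∪ palIntervals .b n)
      ((fun i => (i, i)) '' Set.Iic n) := by
    rw [Set.disjoint_left]
    rintro _ h ⟨k, -, rfl⟩
    rcases h with ⟨h, -⟩ | ⟨h, -⟩ <;> exact lt_irrefl _ h
  rw [e, Set.ncard_union_eq hd hfin ((Set.finite_Iic n).image _),
    Set.ncard_union_eq (palIntervals_disjoint n) (palIntervals_finite _ _)
      (palIntervals_finite _ _),
    Set.ncard_image_of_injective _ (fun x y h => (Prod.mk.inj h).1)]
  simp [Set.ncard_eq_toFinset_card']

theorem ncard_palIntervals_a_imageLength (n : ℕ) :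
    (palIntervals .a (imageLength n + 1)).ncard =
      (palIntervals .a n).ncard + (palIntervals .b n).ncard + (n + 1) := by
  have e : palIntervals .a (imageLength n + 1) =
      (fun q : ℕ × ℕ => (imageLength q.1, imageLength q.2 + 1)) '' palIntervalsWithEmpty n := by
    ext ⟨i, j⟩
    simp only [Set.mem_image, Prod.exists, Prod.mk.injEq]
    constructor
    · rintro ⟨h1, h2, h3, h4⟩
      dsimp only at h1 h2 h3 h4
      obtain ⟨j, rfl⟩ : ∃ k, j = k + 1 := ⟨j - 1, by omega⟩
      have hj := (fibWord_eq_of_seg_palindrome (by omega) h4).trans h3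
      obtain ⟨i', rfl⟩ := exists_imageLength_of_a h3
      obtain ⟨j', rfl⟩ := exists_imageLength_of_a hj
      have hij : i' ≤ j' := imageLength_strictMono.le_iff_le.1 (by omega)
      exact ⟨i', j', ⟨hij, imageLength_strictMono.le_iff_le.1 (by dsimp only; omega),
        (palindrome_seg_imageLength_succ_iff hij).1 h4⟩, rfl, rfl⟩
    · rintro ⟨i', j', ⟨h1, h2, h3⟩, rfl, rfl⟩
      dsimp only at h1 h2 h3
      exact ⟨Nat.lt_succ_of_le (imageLength_strictMono.monotone h1),
        Nat.succ_le_succ (imageLength_strictMono.monotone h2), fibWord_imageLength _,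
        (palindrome_seg_imageLength_succ_iff h1).2 h3⟩
  rw [e, Set.ncard_image_of_injective, ncard_palIntervalsWithEmpty]
  rintro ⟨i, j⟩ ⟨i', j'⟩ h
  simp only [Prod.mk.injEq, add_left_inj, imageLength_strictMono.injective.eq_iff] at h
  exact Prod.ext h.1 h.2

theorem ncard_palIntervals_b_imageLength (n : ℕ) :
    (palIntervals .b (imageLength n + 1)).ncard = (palIntervals .a n).ncard := by
  have e : palIntervals .b (imageLength n + 1) =
      (fun q : ℕ × ℕ => (imageLength q.1 + 1, imageLength q.2)) '' palIntervals .a n := by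
    ext ⟨i, j⟩
    simp only [Set.mem_image, Prod.exists, Prod.mk.injEq]
    constructor
    · rintro ⟨h1, h2, h3, h4⟩
      dsimp only at h1 h2 h3 h4
      obtain ⟨j, rfl⟩ : ∃ k, j = k + 1 := ⟨j - 1, by omega⟩
      have hj := (fibWord_eq_of_seg_palindrome (by omega) h4).trans h3
      obtain ⟨i', hi', rfl⟩ := exists_imageLength_of_b h3
      obtain ⟨j', hj', rfl⟩ := exists_imageLength_of_b hj
      have hij : i' ≤ j' := imageLength_strictMono.le_iff_le.1 (by omega)
      -- The final b completes the image ab of letter `j'`, so the interval ends at `imageLength (j'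
      -- + 1)`; hence the witness `j' + 1` below.
      have hjn : j' < n := imageLength_strictMono.lt_iff_lt.1 (by omega)
      have hL := imageLength_succ_a hj'
      refine ⟨i', j' + 1, ⟨by omega, by omega, hi', ?_⟩, rfl, by omega⟩
      rw [← palindrome_seg_succ_imageLength_iff (by omega), hL]
      exact h4
    · rintro ⟨i', j', ⟨h1, h2, h3, h4⟩, rfl, rfl⟩
      dsimp only at h1 h2 h3 h4
      -- The image of the leading a has two letters, so something remains after its first letter is
      -- removed.
      have hij : imageLength (i' + 1) ≤ imageLength j' := imageLength_strictMono.monotone h1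
      have hjn := imageLength_strictMono.monotone h2
      rw [imageLength_succ_a h3] at hij
      exact ⟨by dsimp only; omega, by dsimp only; omega, fibWord_imageLength_succ h3,
        (palindrome_seg_succ_imageLength_iff h1).2 h4⟩
  rw [e, Set.ncard_image_of_injective]
  rintro ⟨i, j⟩ ⟨i', j'⟩ h
  simp only [Prod.mk.injEq, add_left_inj, imageLength_strictMono.injective.eq_iff] at h
  exact Prod.ext h.1 h.2

theorem occursAt_seg {i j k : ℕ} : OccursAt (seg i j) k ↔ factor k (j - i) = seg i j := by
  rw [OccursAt, seg_length]

/-- Makes the occurrence number determine the position. -/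
theorem ncard_occurrences_lt {w : List Letter} {i k : ℕ} (h : i < k) (hk : OccursAt w k) :
    {j : ℕ | j ≤ i ∧ OccursAt w j}.ncard < {j : ℕ | j ≤ k ∧ OccursAt w j}.ncard := by
  refine Set.ncard_lt_ncard ⟨fun j hj => ⟨hj.1.trans h.le, hj.2⟩, fun hs => ?_⟩
    ((Set.finite_Iic k).subset fun j hj => hj.1)
  have := (hs ⟨le_rfl, hk⟩ : k ≤ i ∧ _).1
  omega

/-- Occurrences of palindromes are the same as nonempty palindromic intervals. -/
theorem A_eq (n : ℕ) : A n = (palIntervals .a n).ncard + (palIntervals .b n).ncard := by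
  rw [A, ← Set.ncard_union_eq (palIntervals_disjoint n) (palIntervals_finite _ _)
    (palIntervals_finite _ _)]
  symm
  have key : ∀ q ∈ palIntervals .a n ∪ palIntervals .b n,
      q.1 < q.2 ∧ q.2 ≤ n ∧ (seg q.1 q.2).Palindrome := by
    rintro q (⟨h1, h2, -, h3⟩ | ⟨h1, h2, -, h3⟩) <;> exact ⟨h1, h2, h3⟩
  refine Set.ncard_congr (fun q _ =>
    (seg q.1 q.2, {j : ℕ | j ≤ q.1 ∧ OccursAt (seg q.1 q.2) j}.ncard)) ?_ ?_ ?_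
  · rintro ⟨i, j⟩ hq
    obtain ⟨h1, h2, h3⟩ := key _ hq
    dsimp only at h1 h2 h3
    have ho : OccursAt (seg i j) i := occursAt_seg.2 rfl
    refine ⟨⟨?_, h3, i, ho⟩, i, ⟨ho, rfl⟩, ?_⟩
    · exact List.ne_nil_of_length_pos (by rw [seg_length]; omega)
    · dsimp only
      rw [seg_length]; omega
  · rintro ⟨i, j⟩ ⟨i', j'⟩ hq hq' h
    have h1 := (key _ hq).1
    have h1' := (key _ hq').1
    dsimp only at h1 h1' h
    obtain ⟨hw, hc⟩ := Prod.mk.inj h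
    have hl := congrArg List.length hw
    rw [seg_length, seg_length] at hl
    have ho : OccursAt (seg i j) i := occursAt_seg.2 rfl
    have ho' : OccursAt (seg i j) i' := by rw [hw]; exact occursAt_seg.2 rfl
    rw [← hw] at hc
    have hi : i = i' := by
      rcases lt_trichotomy i i' with h | h | h
      · exact absurd hc (ncard_occurrences_lt h ho').ne
      · exact h
      · exact absurd hc (ncard_occurrences_lt h ho).ne'
    exact Prod.ext hi (by dsimp only; omega)
  · rintro ⟨w, p⟩ ⟨⟨h1, h2, -⟩, i, ⟨h3, h4⟩, h5⟩
    dsimp only at h1 h2 h3 h4 h5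
    have hpos := List.length_pos_iff.2 h1
    have hs : seg i (i + w.length) = w := by
      rw [seg, Nat.add_sub_cancel_left]; exact h3
    refine ⟨(i, i + w.length), ?_, ?_⟩
    · have h : ∀ c, fibWord i = c → (i, i + w.length) ∈ palIntervals c n := fun c hc =>
        ⟨by dsimp only; omega, h5, hc, by dsimp only; rw [hs]; exact h2⟩
      rcases (fibWord i).eq_a_or_eq_b with e | e
      · exact .inl (h _ e)
      · exact .inr (h _ e)
    · dsimp only
      rw [hs, h4]

/-! ### Prefixes of Fibonacci length -/

theorem f_natCast (m : ℕ) : f m = Nat.fib (m + 2) := by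
  rw [f]; congr 1

/-- The last two letters alternate between ab and ba; only their being distinct matters, as it fixes
the length of their image. -/
theorem finiteWord_eq_append_pair (m : ℕ) :
    ∃ u x y, x ≠ y ∧ finiteWord (m + 1) = u ++ [x, y] := by
  induction m using Nat.twoStepInduction with
  | zero => exact ⟨[], .a, .b, by simp, rfl⟩
  | one => exact ⟨[.a], .b, .a, by simp, rfl⟩
  | more m ih _ =>
    obtain ⟨u, x, y, h, e⟩ := ih
    exact ⟨finiteWord (m + 2) ++ u, x, y, h, by
      rw [finiteWord_add_two (m + 1), e, List.append_assoc]⟩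

theorem imageLength_fib_sub_two (m : ℕ) :
    imageLength (Nat.fib (m + 3) - 2) + 1 = Nat.fib (m + 4) - 2 := by
  obtain ⟨u, x, y, hxy, e⟩ := finiteWord_eq_append_pair m
  have h1 := congrArg List.length e
  rw [finiteWord_length, f_natCast, List.length_append] at h1
  have h2 : _ = Nat.fib (m + 4) := (finiteWord_length (m + 2)).trans (f_natCast _)
  rw [ finiteWord_succ, e, sigma_append, List.length_append] at h2
  have hp : factor 0 u.length = u :=
    factor_of_prefix (m := m + 1) (e ▸ List.prefix_append _ _)
  -- One a and one b, so 2 + 1: the image of the shortened prefix is three letters short of the next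
  -- Fibonacci length, and the added a makes it two.
  have h3 : (sigma [x, y]).length = 3 := by
    cases x <;> cases y <;> first | rfl | exact absurd rfl hxy
  have h4 : Nat.fib (m + 3) - 2 = u.length := by rw [h1]; rfl
  rw [h4, imageLength, hp]
  omega

theorem palIntervals_zero (c : Letter) : palIntervals c 0 = ∅ := by
  ext ⟨i, j⟩
  simp only [palIntervals, Set.mem_ofPred_eq, Set.mem_empty_iff_false, iff_false]
  omega

theorem A_zero : A 0 = 0 := by simp [A_eq, palIntervals_zero]

theorem A_one : A 1 = 1 := by
  have ha := ncard_palIntervals_a_imageLength 0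
  have hb := ncard_palIntervals_b_imageLength 0
  simp only [palIntervals_zero, imageLength_zero, Set.ncard_empty, zero_add] at ha hb
  rw [A_eq, ha, hb]

theorem two_le_fib (m : ℕ) : 2 ≤ Nat.fib (m + 3) :=
  Nat.fib_mono (show 3 ≤ m + 3 by omega)

theorem A_fib_recurrence (m : ℕ) :
    A (Nat.fib (m + 5) - 2) + 2 =
      A (Nat.fib (m + 4) - 2) + A (Nat.fib (m + 3) - 2) + Nat.fib (m + 5) := by
  have a1 := ncard_palIntervals_a_imageLength (Nat.fib (m + 3) - 2)
  have b1 := ncard_palIntervals_b_imageLength (Nat.fib (m + 3) - 2)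
  have a2 := ncard_palIntervals_a_imageLength (Nat.fib (m + 4) - 2)
  have b2 := ncard_palIntervals_b_imageLength (Nat.fib (m + 4) - 2)
  rw [imageLength_fib_sub_two] at a1 b1
  rw [imageLength_fib_sub_two (m + 1)] at a2 b2
  have h3 := two_le_fib m
  have h4 := two_le_fib (m + 1)
  have h5 : Nat.fib (m + 5) = Nat.fib (m + 3) + Nat.fib (m + 4) := Nat.fib_add_two
  -- The b-count at the top level is the a-count one level down, which is the total two levels down
  -- plus its length plus one.
  simp only [A_eq, add_assoc, Nat.reduceAdd] at *
  omega

theorem A_fib_closed (m : ℕ) :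
    (5 * A (Nat.fib (m + 3) - 2) : ℚ) =
      (m - 2) * Nat.fib (m + 5) + m * Nat.fib (m + 3) + 10 := by
  induction m using Nat.twoStepInduction with
  | zero =>
    have h : Nat.fib 3 - 2 = 0 := rfl
    have h5 : Nat.fib 5 = 5 := rfl
    simp only [zero_add, h, A_zero, h5]; norm_num
  | one =>
    have h : Nat.fib 4 - 2 = 1 := rfl
    have h6 : Nat.fib 6 = 8 := rfl
    have h4 : Nat.fib 4 = 3 := rfl
    rw [h, A_one, h6, h4]; norm_num
  | more m ih1 ih2 =>
    have hr : (A (Nat.fib (m + 5) - 2) + 2 : ℚ) =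
      A (Nat.fib (m + 4) - 2) + A (Nat.fib (m + 3) - 2) + Nat.fib (m + 5) := by
        exact_mod_cast A_fib_recurrence m
    have h5 : (Nat.fib (m + 5) : ℚ) = Nat.fib (m + 3) + Nat.fib (m + 4) := by
      exact_mod_cast (Nat.fib_add_two (n := m + 3))
    have h6 : (Nat.fib (m + 6) : ℚ) = Nat.fib (m + 4) + Nat.fib (m + 5) := by
      exact_mod_cast (Nat.fib_add_two (n := m + 4))
    have h7 : (Nat.fib (m + 7) : ℚ) = Nat.fib (m + 5) + Nat.fib (m + 6) := by
      exact_mod_cast (Nat.fib_add_two (n := m + 5))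
    simp only [add_assoc, Nat.reduceAdd] at *
    push_cast at *
    rw [h7, h6, h5]
    rw [h6, h5] at ih2
    rw [h5] at ih1 hr
    linear_combination 5 * hr + ih1 + ih2

/-! ### Convolution of Fibonacci numbers -/

/-- The Fibonacci recurrence is applied to the second factor for k ≤ n; the two remaining terms
supply the missing last term of the first sum and the extra `Nat.fib (n + 3)`. -/
theorem sum_fib_mul_fib_add_two (n : ℕ) :
    ∑ k ∈ Finset.range (n + 3), Nat.fib (k + 1) * Nat.fib (n + 2 - k + 1) =
      ∑ k ∈ Finset.range (n + 2), Nat.fib (k + 1) * Nat.fib (n + 1 - k + 1) +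
        ∑ k ∈ Finset.range (n + 1), Nat.fib (k + 1) * Nat.fib (n - k + 1) +
          Nat.fib (n + 3) := by
  have h : ∀ k ∈ Finset.range (n + 1), Nat.fib (k + 1) * Nat.fib (n + 2 - k + 1) =
      Nat.fib (k + 1) * Nat.fib (n + 1 - k + 1) + Nat.fib (k + 1) * Nat.fib (n - k + 1) := by
    intro k hk
    have hk := Finset.mem_range.1 hk
    rw [show n + 2 - k + 1 = n - k + 1 + 2 by omega, show n + 1 - k + 1 = n - k + 1 + 1 by omega,
      Nat.fib_add_two]
    ring
  rw [Finset.sum_range_succ, Finset.sum_range_succ, Finset.sum_congr rfl h,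
    Finset.sum_add_distrib, Finset.sum_range_succ _ (n + 1)]
  simp only [show n + 2 - (n + 1) + 1 = 2 by omega, Nat.sub_self, Nat.fib_two, Nat.fib_one,
    Nat.zero_add]
  ring

theorem sum_fib_mul_fib (n : ℕ) :
    5 * ∑ k ∈ Finset.range (n + 1), Nat.fib (k + 1) * Nat.fib (n - k + 1) =
      (n + 1) * Nat.fib (n + 3) + (n + 3) * Nat.fib (n + 1) := by
  induction n using Nat.twoStepInduction with
  | zero => rfl
  | one => rfl
  | more n ih1 ih2 =>
    have h3 : Nat.fib (n + 3) = Nat.fib (n + 1) + Nat.fib (n + 2) := Nat.fib_add_two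
    have h4 : Nat.fib (n + 4) = Nat.fib (n + 2) + Nat.fib (n + 3) := Nat.fib_add_two
    have h5 : Nat.fib (n + 5) = Nat.fib (n + 3) + Nat.fib (n + 4) := Nat.fib_add_two
    rw [sum_fib_mul_fib_add_two, mul_add, mul_add, ih1, ih2]
    simp only [add_assoc, Nat.reduceAdd]
    rw [h5, h4, h3]
    ring

theorem f_of_eq {i : ℤ} {k : ℕ} (h : i + 2 = k) : f i = Nat.fib k := by
  rw [f, h, Int.toNat_natCast]

theorem sum_f_mul_f (n : ℕ) :
    ∑ i ∈ Finset.Icc (-1 : ℤ) n, (f i : ℚ) * (f (n - i - 1) : ℚ) =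
      ∑ k ∈ Finset.range (n + 2), (Nat.fib (k + 1) : ℚ) * Nat.fib (n + 1 - k + 1) := by
  symm
  refine Finset.sum_bij (fun k _ => (k : ℤ) - 1) ?_ ?_ ?_ ?_
  · intro k hk
    rw [Finset.mem_range] at hk
    rw [Finset.mem_Icc]
    omega
  · intro k _ l _ h
    omega
  · intro i hi
    rw [Finset.mem_Icc] at hi
    exact ⟨(i + 1).toNat, by rw [Finset.mem_range]; omega, by omega⟩
  · intro k hk
    rw [Finset.mem_range] at hk
    rw [f_of_eq (k := k + 1) (by push_cast; ring),
      f_of_eq (i := (n : ℤ) - (k - 1) - 1) (k := n + 1 - k + 1) (by omega)]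

theorem C_recurrence (k : ℕ) :
    C (k + 3) = C (k + 3 - 1) + C (k + 3 - 2) + (f (k + 3 - 1) : ℤ) := by
  have h1 := A_fib_recurrence k
  have h2 := A_fib_recurrence (k + 1)
  have h6 : Nat.fib (k + 6) = Nat.fib (k + 4) + Nat.fib (k + 5) := Nat.fib_add_two
  simp only [add_assoc, Nat.reduceAdd] at h2
  simp only [C]
  rw [f_of_eq (i := (k : ℤ) + 3 + 1) (k := k + 6) (by push_cast; ring),
    f_of_eq (i := (k : ℤ) + 3) (k := k + 5) (by push_cast; ring),
    f_of_eq (i := (k : ℤ) + 3 - 1 + 1) (k := k + 5) (by push_cast; ring),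
    f_of_eq (i := (k : ℤ) + 3 - 1) (k := k + 4) (by push_cast; ring),
    f_of_eq (i := (k : ℤ) + 3 - 2 + 1) (k := k + 4) (by push_cast; ring),
    f_of_eq (i := (k : ℤ) + 3 - 2) (k := k + 3) (by push_cast; ring)]
  omega

end FibPal

theorem mainTheorem7 :
    (∀ m : ℤ, 2 ≤ m →
      (FibPal.A (FibPal.f m - 2) : ℚ) =
          (∑ i ∈ Finset.Icc (-1) m, (FibPal.f i : ℚ) * (FibPal.f (m - i - 1) : ℚ))
            - (FibPal.f (m + 2) : ℚ) - (FibPal.f m : ℚ) + 2 ∧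
      (FibPal.A (FibPal.f m - 2) : ℚ) =
          ((m : ℚ) - 3) / 5 * (FibPal.f (m + 2) : ℚ)
            + ((m : ℚ) - 1) / 5 * (FibPal.f m : ℚ) + 2) ∧
    (∀ m : ℤ, 3 ≤ m →
      FibPal.C m = FibPal.C (m - 1) + FibPal.C (m - 2) + (FibPal.f (m - 1) : ℤ)) := by
  refine ⟨fun m hm => ?_, fun m hm => ?_⟩
  -- With m = n + 1, `FibPal.f m` is `Nat.fib (n + 3)`, the indexing of `FibPal.A_fib_closed`.
  · obtain ⟨n, rfl⟩ : ∃ n : ℕ, m = ((n + 1 : ℕ) : ℤ) := ⟨(m - 1).toNat, by omega⟩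
    have hA := FibPal.A_fib_closed n
    have hS : (5 * ∑ k ∈ Finset.range (n + 3), (Nat.fib (k + 1) : ℚ) * Nat.fib (n + 2 - k + 1)) =
        (n + 3) * Nat.fib (n + 5) + (n + 5) * Nat.fib (n + 3) := by
      exact_mod_cast FibPal.sum_fib_mul_fib (n + 2)
    rw [FibPal.sum_f_mul_f,
      FibPal.f_of_eq (i := ((n + 1 : ℕ) : ℤ)) (k := n + 3) (by push_cast; ring),
      FibPal.f_of_eq (i := ((n + 1 : ℕ) : ℤ) + 2) (k := n + 5) (by push_cast; ring)]
    push_cast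
    constructor
    · linear_combination hA / 5 - hS / 5
    · linear_combination hA / 5
  · obtain ⟨k, rfl⟩ : ∃ k : ℕ, m = k + 3 := ⟨(m - 3).toNat, by omega⟩
    exact FibPal.C_recurrence k
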